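/- **Definitions.** An $\mathbb R$-tree is a metric space $(\mathcal V,d)$ such that (i) for all $x,y\in\mathcal V$ there is a unique isometry $f_{x,y}:[0,d(x,y)]\to\mathcal V$ with $f_{x,y}(0)=x$ and $f_{x,y}(d(x,y))=y$, and (ii) any two continuous injective maps $[0,1]\to\mathcal V$ with the same starting point and the same endpoint have the same image. The closed, half-open and open segments $[[x,y]]$, $[[x,y[[$ and $]]x,y[[$ are the images under $f_{x,y}$ of $[0,d(x,y)]$, $[0,d(x,y))$ and $(0,d(x,y))$. Let $\mathfrak T$ be the set of complete, locally compact, rooted measured $\mathbb R$-trees $\mathcal T=(\mathcal V,d,\rho,\mu)$, where $\rho\in\mathcal V$ and $\mu$ is a Borel measure on $\mathcal V$ that is finite on bounded Borel sets, modulo root- and measure-preserving isometries. The length measure $\ell_{\mathcal T}$ of $\mathcal T$ is the unique $\sigma$-finite Borel measure on $\mathcal V$ with $\ell_{\mathcal T}(]]a,b[[)=d(a,b)$ for all $a,b\in\mathcal V$ and $\ell_{\mathcal T}(\mathcal V\setminus\mathcal V^\circ)=0$, where $\mathcal V^\circ=\bigcup_{x\in\mathcal V}[[\rho,x[[$. An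 end of $\mathcal T$ is a set $\bigcup_n[[\rho,x_n]]$ where $x_n\in[[\rho,x_{n+1}]]$ for all $n$ and $d(\rho,x_n)\to\infty$. For rooted measured metric spaces $\mathcal X=(X,d_X,x,\mu)$ and $\mathcal Y=(Y,d_Y,y,\nu)$ let $$d^c_{GHP}(\mathcal X,\mathcal Y)=\inf\left[d^Z(\varphi(x),\psi(y))+d^Z_H(\varphi(X),\psi(Y))+d^Z_P(\varphi_*\mu,\psi_*\nu)\right],$$ where the infimum is over all isometric embeddings $\varphi:X\to Z$, $\psi:Y\to Z$ into a complete separable metric space $Z$, and $d^Z_H$, $d^Z_P$ are the Hausdorff and Prokhorov distances in $Z$. The GHP topology on $\mathfrak T$ is the topology of the metric $$d_{GHP}(\mathcal T,\mathcal T')=\int_0^\infty e^{-r}\left(1\wedge d^c_{GHP}(\mathcal T^{\le r},\mathcal T'^{\le r})\right)dr,$$ where $\mathcal T^{\le r}$ is the restriction of $\mathcal T$ (space and measure) to the closed ball of radius $r$ around the root. Subsets of $\mathfrak T$ carry the induced topology. Let $\mathfrak T_e\subset\mathfrak T$ be the set of trees with finitely many ends, $\mathfrak T_f$ the set of compact trees,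 and $\mathfrak T_1$ the set of compact trees for which $\mu$ is a probability measure. Put $$\mathfrak T_e^\ell=\{(\mathcal V,d,\rho,\mu)\in\mathfrak T_e:\mu\ge\ell_{\mathcal T}\},\qquad \mathfrak T_f^\ell=\mathfrak T_f\cap\mathfrak T_e^\ell,\qquad \mathfrak T_1^\ell=\mathfrak T_1\cap\mathfrak T_e^\ell.$$ **Proposition 3.2.** The sets $\mathfrak T_e^\ell$, $\mathfrak T_f^\ell$ and $\mathfrak T_1^\ell$ are closed in $\mathfrak T_e$, $\mathfrak T_f$ and $\mathfrak T_1$ respectively, for the GHP topology. The statements for $\mathfrak T_f$ and $\mathfrak T_1$ also hold if these are instead taken to be the sets of trees in $\mathfrak T_e$ for which $\mu$ is finite, respectively a probability measure (compactness not being required). -/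

import Mathlib

open Set Filter Topology MeasureTheory
open scoped ENNReal NNReal

/-- An `ℝ`-tree: a metric space that is geodesically linear (between any two points there is
exactly one isometric parametrisation of a segment) and without loops. -/
structure IsRTree (V : Type) [MetricSpace V] : Prop where
  geodesic : ∀ x y : V, ∃! f : Icc (0 : ℝ) (dist x y) → V,
    Isometry f ∧ f ⟨0, left_mem_Icc.2 dist_nonneg⟩ = x ∧
      f ⟨dist x y, right_mem_Icc.2 dist_nonneg⟩ = y
  noLoop : ∀ (x y : V) (q r : Icc (0 : ℝ) 1 → V),
    Continuous q → Function.Injective q → Continuous r → Function.Injective r →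
    q 0 = x → q 1 = y → r 0 = x → r 1 = y → range q = range r

/-- A complete, locally compact, rooted, measured `ℝ`-tree `(V, d, root, μ)` whose Borel measure
`μ` is boundedly finite. Complete locally compact `ℝ`-trees are separable, so every such tree has
an isometric copy in `Type`. -/
structure MeasuredTree where
  V : Type
  [metric : MetricSpace V]
  [measurable : MeasurableSpace V]
  [borel : BorelSpace V]
  [complete : CompleteSpace V]
  [locallyCompact : LocallyCompactSpace V]
  isRTree : IsRTree V
  root : V
  μ : Measure V
  boundedlyFinite : ∀ A : Set V, Bornology.IsBounded A → MeasurableSet A → μ A < ∞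

attribute [instance] MeasuredTree.metric MeasuredTree.measurable MeasuredTree.borel
  MeasuredTree.complete MeasuredTree.locallyCompact

namespace MeasuredTree

/-! ### Segments, order, ends and length measure -/

/-- The unique isometry `f_{x,y} : [0, d(x,y)] → V` from `x` to `y`. -/
noncomputable def geod (T : MeasuredTree) (x y : T.V) : Icc (0 : ℝ) (dist x y) → T.V :=
  (T.isRTree.geodesic x y).choose

/-- The closed segment `⟦x, y⟧`. -/
def seg (T : MeasuredTree) (x y : T.V) : Set T.V := range (T.geod x y)

/-- The half-open segment `⟦x, y⟦`. -/
def segHalfOpen (T : MeasuredTree) (x y : T.V) : Set T.V :=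
  T.geod x y '' {t | (t : ℝ) < dist x y}

/-- The open segment `⟧x, y⟦`. -/
def segOpen (T : MeasuredTree) (x y : T.V) : Set T.V :=
  T.geod x y '' {t | 0 < (t : ℝ) ∧ (t : ℝ) < dist x y}

/-- `x` is an ancestor of `y` (possibly `x = y`). -/
def Ancestor (T : MeasuredTree) (x y : T.V) : Prop := x ∈ T.seg T.root y

/-- `E` is an end: an infinite ray `⋃ₙ ⟦root, xₙ⟧` with `xₙ` an ancestor of `xₙ₊₁` for all `n` and
`d(root, xₙ) → ∞`. -/
def IsEnd (T : MeasuredTree) (E : Set T.V) : Prop :=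
  ∃ x : ℕ → T.V, (∀ n, T.Ancestor (x n) (x (n + 1))) ∧
    Tendsto (fun n => dist T.root (x n)) atTop atTop ∧ E = ⋃ n, T.seg T.root (x n)

/-- The tree has only finitely many ends. -/
def FinitelyManyEnds (T : MeasuredTree) : Prop := {E : Set T.V | T.IsEnd E}.Finite

/-- The skeleton `V° = ⋃ₓ ⟦root, x⟦`. -/
def skeleton (T : MeasuredTree) : Set T.V := ⋃ x : T.V, T.segHalfOpen T.root x

/-- `ℓ` is the length measure of the tree: the (unique) `σ`-finite Borel measure giving each open
segment its length and giving mass zero to the complement of the skeleton. -/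
structure IsLengthMeasure (T : MeasuredTree) (ℓ : Measure T.V) : Prop where
  sigmaFinite : SigmaFinite ℓ
  segOpen : ∀ a b : T.V, ℓ (T.segOpen a b) = ENNReal.ofReal (dist a b)
  compl_skeleton : ℓ T.skeletonᶜ = 0

/-- The measure `μ` of the tree dominates its length measure: `μ ≥ ℓ`. -/
def DominatesLength (T : MeasuredTree) : Prop := ∃ ℓ : Measure T.V, T.IsLengthMeasure ℓ ∧ ℓ ≤ T.μ

/-! ### Equivalence of trees -/

/-- Existence of a root- and measure-preserving isometry. -/
def Equivalent (T T' : MeasuredTree) : Prop :=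
  ∃ e : T.V ≃ᵢ T'.V, e T.root = T'.root ∧ T.μ.map e = T'.μ

theorem Equivalent.refl (T : MeasuredTree) : Equivalent T T :=
  ⟨IsometryEquiv.refl _, rfl, by
    change Measure.map id _ = _
    exact Measure.map_id⟩

theorem Equivalent.symm {T T' : MeasuredTree} (h : Equivalent T T') : Equivalent T' T := by
  obtain ⟨e, h1, h2⟩ := h
  refine ⟨e.symm, by rw [← h1, e.symm_apply_apply], ?_⟩
  rw [← h2, Measure.map_map e.symm.continuous.measurable e.continuous.measurable]
  have h : (e.symm : T'.V → T.V) ∘ e = id := funext e.symm_apply_apply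
  rw [h, Measure.map_id]

theorem Equivalent.trans {T T' T'' : MeasuredTree} (h : Equivalent T T') (h' : Equivalent T' T'') :
    Equivalent T T'' := by
  obtain ⟨e, h1, h2⟩ := h
  obtain ⟨e', h1', h2'⟩ := h'
  refine ⟨e.trans e', by simp [h1, h1'], ?_⟩
  rw [← h2', ← h2, Measure.map_map e'.continuous.measurable e.continuous.measurable]
  rfl

instance setoid : Setoid MeasuredTree where
  r := Equivalent
  iseqv := ⟨Equivalent.refl, Equivalent.symm, Equivalent.trans⟩

end MeasuredTree

/-! ### The Gromov-Hausdorff-Prokhorov distance -/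

/-- The compact Gromov-Hausdorff-Prokhorov distance between rooted measured metric spaces
`(X, x, μ)` and `(Y, y, ν)`: the infimum of
`d(φ x, ψ y) + d_H(φ X, ψ Y) + d_P(φ_* μ, ψ_* ν)` over all isometric embeddings `φ`, `ψ` into
complete separable metric spaces `Z`. -/
noncomputable def ghpcDist {X Y : Type} [MetricSpace X] [MeasurableSpace X]
    [MetricSpace Y] [MeasurableSpace Y] (x : X) (μ : Measure X) (y : Y) (ν : Measure Y) : ℝ≥0∞ :=
  ⨅ (Z : Type) (_ : MetricSpace Z) (_ : CompleteSpace Z) (_ : TopologicalSpace.SeparableSpace Z)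
    (_ : MeasurableSpace Z) (_ : BorelSpace Z) (φ : X → Z) (ψ : Y → Z)
    (_ : Isometry φ) (_ : Isometry ψ),
    edist (φ x) (ψ y) + Metric.hausdorffEDist (range φ) (range ψ)
      + levyProkhorovEDist (μ.map φ) (ν.map ψ)

theorem ghpcDist_le_of_isometryEquiv {X X' Y Y' : Type}
    [MetricSpace X] [MeasurableSpace X] [BorelSpace X]
    [MetricSpace X'] [MeasurableSpace X'] [BorelSpace X']
    [MetricSpace Y] [MeasurableSpace Y] [BorelSpace Y]
    [MetricSpace Y'] [MeasurableSpace Y'] [BorelSpace Y']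
    (e : X ≃ᵢ X') (e' : Y ≃ᵢ Y') (x : X) (μ : Measure X) (y : Y) (ν : Measure Y) :
    ghpcDist x μ y ν ≤ ghpcDist (e x) (μ.map e) (e' y) (ν.map e') := by
  unfold ghpcDist
  refine le_iInf fun Z => le_iInf fun _ => le_iInf fun _ => le_iInf fun _ => le_iInf fun _ =>
    le_iInf fun _ => le_iInf fun φ => le_iInf fun ψ => le_iInf fun hφ => le_iInf fun hψ => ?_
  refine iInf_le_of_le Z <| iInf_le_of_le _ <| iInf_le_of_le ‹_› <| iInf_le_of_le ‹_› <|
    iInf_le_of_le _ <| iInf_le_of_le ‹_› <| iInf_le_of_le (φ ∘ e) <| iInf_le_of_le (ψ ∘ e') <|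
    iInf_le_of_le (hφ.comp e.isometry) <| iInf_le_of_le (hψ.comp e'.isometry) ?_
  rw [e.surjective.range_comp, e'.surjective.range_comp,
    Measure.map_map hφ.continuous.measurable e.continuous.measurable,
    Measure.map_map hψ.continuous.measurable e'.continuous.measurable]
  rfl

namespace MeasuredTree

/-- The vertex set of the restriction of a tree to the closed ball of radius `r` around the root. -/
abbrev ball (T : MeasuredTree) (r : ℝ≥0) : Type := Metric.closedBall T.root (r : ℝ)

/-- The root of the restricted tree. -/
def ballRoot (T : MeasuredTree) (r : ℝ≥0) : T.ball r :=
  ⟨T.root, Metric.mem_closedBall_self r.coe_nonneg⟩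

/-- The measure of the restricted tree. -/
noncomputable def ballMeasure (T : MeasuredTree) (r : ℝ≥0) : Measure (T.ball r) :=
  T.μ.comap Subtype.val

/-- The Gromov-Hausdorff-Prokhorov distance
`∫₀^∞ e^{-r} (1 ∧ d^c(T^{≤ r}, T'^{≤ r})) dr`. -/
noncomputable def ghpDist (T T' : MeasuredTree) : ℝ≥0∞ :=
  ∫⁻ r in Ioi (0 : ℝ), ENNReal.ofReal (Real.exp (-r)) *
    min 1 (ghpcDist (T.ballRoot r.toNNReal) (T.ballMeasure r.toNNReal)
      (T'.ballRoot r.toNNReal) (T'.ballMeasure r.toNNReal))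

theorem Equivalent.ball {T T' : MeasuredTree} (h : Equivalent T T') (r : ℝ≥0) :
    ∃ e : T.ball r ≃ᵢ T'.ball r, e (T.ballRoot r) = T'.ballRoot r ∧
      (T.ballMeasure r).map e = T'.ballMeasure r := by
  obtain ⟨e, h1, h2⟩ := h
  have key : ∀ a, a ∈ Metric.closedBall T.root (r : ℝ) ↔
      e a ∈ Metric.closedBall T'.root (r : ℝ) := fun a => by
    rw [Metric.mem_closedBall, Metric.mem_closedBall, ← h1, e.dist_eq]
  let E : T.ball r ≃ᵢ T'.ball r :=
    ⟨e.toEquiv.subtypeEquiv key, fun a b => e.isometry a.1 b.1⟩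
  refine ⟨E, Subtype.ext h1, ?_⟩
  ext s hs
  rw [Measure.map_apply E.continuous.measurable hs]
  unfold ballMeasure
  rw [(MeasurableEmbedding.subtype_coe Metric.isClosed_closedBall.measurableSet).comap_apply,
    (MeasurableEmbedding.subtype_coe Metric.isClosed_closedBall.measurableSet).comap_apply,
    ← h2, Measure.map_apply e.continuous.measurable
      ((MeasurableEmbedding.subtype_coe
        Metric.isClosed_closedBall.measurableSet).measurableSet_image.2 hs)]
  congr 1
  ext a
  constructor
  · rintro ⟨b, hb, rfl⟩
    exact ⟨E b, hb, rfl⟩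
  · rintro ⟨c, hc, hca⟩
    refine ⟨⟨a, (key a).2 (hca ▸ c.2)⟩, ?_, rfl⟩
    have : E ⟨a, (key a).2 (hca ▸ c.2)⟩ = c := Subtype.ext hca.symm
    rw [mem_preimage, this]
    exact hc

theorem ghpDist_le_of_equivalent {T₁ T₁' T₂ T₂' : MeasuredTree} (h₁ : Equivalent T₁ T₁')
    (h₂ : Equivalent T₂ T₂') : ghpDist T₁ T₂ ≤ ghpDist T₁' T₂' := by
  refine lintegral_mono fun r => ?_
  obtain ⟨e, he, he'⟩ := h₁.ball r.toNNReal
  obtain ⟨f, hf, hf'⟩ := h₂.ball r.toNNReal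
  dsimp only
  gcongr
  rw [← he, ← he', ← hf, ← hf']
  exact ghpcDist_le_of_isometryEquiv e f _ _ _ _

end MeasuredTree

/-! ### The space of trees and its subspaces -/

/-- The space `𝔗` of complete, locally compact, rooted `ℝ`-trees with a boundedly finite measure,
modulo root- and measure-preserving isometries. -/
def TreeSpace : Type 1 := Quotient MeasuredTree.setoid

namespace TreeSpace

/-- The equivalence class of a tree. -/
def mk (T : MeasuredTree) : TreeSpace := Quotient.mk MeasuredTree.setoid T

/-- The Gromov-Hausdorff-Prokhorov metric on `𝔗`. -/
noncomputable def ghpDist : TreeSpace → TreeSpace → ℝ≥0∞ :=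
  Quotient.lift₂ MeasuredTree.ghpDist fun _ _ _ _ h₁ h₂ =>
    le_antisymm (MeasuredTree.ghpDist_le_of_equivalent h₁ h₂)
      (MeasuredTree.ghpDist_le_of_equivalent h₁.symm h₂.symm)

/-- The GHP topology, i.e. the topology of the metric `ghpDist`: a set is open when it contains
a ball around each of its points. -/
instance : TopologicalSpace TreeSpace where
  IsOpen U := ∀ t ∈ U, ∃ ε : ℝ≥0∞, 0 < ε ∧ ∀ t', ghpDist t t' < ε → t' ∈ U
  isOpen_univ := fun _ _ => ⟨1, one_pos, fun _ _ => mem_univ _⟩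
  isOpen_inter := fun U W hU hW t ht => by
    obtain ⟨ε, hε, h⟩ := hU t ht.1
    obtain ⟨δ, hδ, h'⟩ := hW t ht.2
    exact ⟨min ε δ, lt_min hε hδ, fun t' ht' =>
      ⟨h t' (ht'.trans_le (min_le_left _ _)), h' t' (ht'.trans_le (min_le_right _ _))⟩⟩
  isOpen_sUnion := fun S hS t ⟨U, hU, ht⟩ => by
    obtain ⟨ε, hε, h⟩ := hS U hU t ht
    exact ⟨ε, hε, fun t' ht' => ⟨U, hU, h t' ht'⟩⟩

/-- `𝔗_e`: trees with finitely many ends. -/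
def finEnds : Set TreeSpace := mk '' {T | T.FinitelyManyEnds}

/-- `𝔗_f`: compact trees. -/
def compactTrees : Set TreeSpace := mk '' {T | CompactSpace T.V}

/-- `𝔗₁`: compact trees whose measure is a probability measure. -/
def probTrees : Set TreeSpace := mk '' {T | CompactSpace T.V ∧ IsProbabilityMeasure T.μ}

/-- Trees with finitely many ends and finite measure, not necessarily compact. -/
def finEndsFiniteMeasure : Set TreeSpace := mk '' {T | T.FinitelyManyEnds ∧ IsFiniteMeasure T.μ}

/-- Trees with finitely many ends and a probability measure, not necessarily compact. -/
def finEndsProbMeasure : Set TreeSpace :=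
  mk '' {T | T.FinitelyManyEnds ∧ IsProbabilityMeasure T.μ}

/-- `𝔗_e^ℓ`: trees with finitely many ends whose measure dominates the length measure. -/
def finEndsLength : Set TreeSpace := mk '' {T | T.FinitelyManyEnds ∧ T.DominatesLength}

/-- `𝔗_f^ℓ = 𝔗_f ∩ 𝔗_e^ℓ`. -/
def compactTreesLength : Set TreeSpace := compactTrees ∩ finEndsLength

/-- `𝔗₁^ℓ = 𝔗₁ ∩ 𝔗_e^ℓ`. -/
def probTreesLength : Set TreeSpace := probTrees ∩ finEndsLength

end TreeSpace

/-!
Domination of the length measure passes to GHP limits among all trees of `𝔗`, whatever their ends;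
all five claims follow by intersecting the closed set `TreeSpace.dominating` with the respective
subspace, a compact tree having no ends at all.

Suppose that trees `T'` with `μ' ≥ ℓ'` come arbitrarily close to `T`. Balls of `T` and `T'` of some
large radius then embed into a common space `Z` at GHP distance less than `δ`. Given `x` in the ball
of `T`, choose `x'` in that of `T'` within `δ` of it in `Z`. Since `T'` is a tree, points at equal
height on `⟦root, x⟧` and `⟦root', x'⟧` are within `8 * δ` in `Z` (`MeasuredTree.dist_path_path_le`,
which rests on the existence of medians). For a set `C` of heights with image `K` in `⟦root, x⟧`, the
points of `⟦root', x'⟧` with height in `C` have `ℓ'`-mass at least `volume C - 2 * δ`, hence at least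
as much `μ'`-mass, and by the Prokhorov bound the `10 * δ`-neighbourhood of `K` has `μ`-mass at least
`volume C - 3 * δ` (`MeasuredTree.volume_le_measure_thickening_add`). Letting `δ → 0` gives
`volume C ≤ μ K` for compact `C`.

The length measure of `T` is one-dimensional Hausdorff measure restricted to the skeleton, which is a
countable union of half-open segments from the root: `T` is separable because its balls embed into
separable spaces. Inner regularity of Lebesgue measure extends the bound from compact to Borel subsets
of a segment, and summing over disjointed segments yields `ℓ ≤ μ`
(`MeasuredTree.dominatesLength_of_volume_le`).
-/

namespace MeasuredTree

/-! ### Geodesics and segments -/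

theorem geod_isometry (T : MeasuredTree) (x y : T.V) : Isometry (T.geod x y) :=
  (T.isRTree.geodesic x y).choose_spec.1.1

/-- The geodesic from `x` to `y`, extended to a map on `ℝ` that is constant outside
`[0, dist x y]`. -/
noncomputable def path (T : MeasuredTree) (x y : T.V) (t : ℝ) : T.V :=
  T.geod x y (projIcc 0 (dist x y) dist_nonneg t)

theorem path_of_mem (T : MeasuredTree) (x y : T.V) {t : ℝ} (ht : t ∈ Icc 0 (dist x y)) :
    T.path x y t = T.geod x y ⟨t, ht⟩ := by
  rw [path, projIcc_of_mem _ ht]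

theorem path_zero (T : MeasuredTree) (x y : T.V) : T.path x y 0 = x := by
  rw [path_of_mem _ _ _ (left_mem_Icc.2 dist_nonneg)]
  exact (T.isRTree.geodesic x y).choose_spec.1.2.1

theorem path_dist (T : MeasuredTree) (x y : T.V) : T.path x y (dist x y) = y := by
  rw [path_of_mem _ _ _ (right_mem_Icc.2 dist_nonneg)]
  exact (T.isRTree.geodesic x y).choose_spec.1.2.2

theorem continuous_path (T : MeasuredTree) (x y : T.V) : Continuous (T.path x y) :=
  (T.geod_isometry x y).continuous.comp continuous_projIcc

theorem dist_path_path (T : MeasuredTree) (x y : T.V) {s t : ℝ} (hs : s ∈ Icc 0 (dist x y))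
    (ht : t ∈ Icc 0 (dist x y)) : dist (T.path x y s) (T.path x y t) = |s - t| := by
  rw [path_of_mem _ _ _ hs, path_of_mem _ _ _ ht, (T.geod_isometry x y).dist_eq,
    Subtype.dist_eq, Real.dist_eq]

theorem dist_left_path (T : MeasuredTree) (x y : T.V) {t : ℝ} (ht : t ∈ Icc 0 (dist x y)) :
    dist x (T.path x y t) = t := by
  have h := T.dist_path_path x y (left_mem_Icc.2 dist_nonneg) ht
  rwa [path_zero, zero_sub, abs_neg, abs_of_nonneg ht.1] at h

theorem dist_path_right (T : MeasuredTree) (x y : T.V) {t : ℝ} (ht : t ∈ Icc 0 (dist x y)) :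
    dist (T.path x y t) y = dist x y - t := by
  have h := T.dist_path_path x y ht (right_mem_Icc.2 dist_nonneg)
  rwa [path_dist, abs_sub_comm, abs_of_nonneg (sub_nonneg.2 ht.2)] at h

theorem injOn_path (T : MeasuredTree) (x y : T.V) : InjOn (T.path x y) (Icc 0 (dist x y)) :=
  fun s hs t ht h => by
    rw [← T.dist_left_path x y hs, h, T.dist_left_path x y ht]

theorem seg_eq_image (T : MeasuredTree) (x y : T.V) :
    T.seg x y = T.path x y '' Icc 0 (dist x y) := by
  ext c
  constructor
  · rintro ⟨t, rfl⟩
    exact ⟨t, t.2, T.path_of_mem x y t.2⟩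
  · rintro ⟨t, ht, rfl⟩
    exact ⟨⟨t, ht⟩, (T.path_of_mem x y ht).symm⟩

theorem isCompact_seg (T : MeasuredTree) (x y : T.V) : IsCompact (T.seg x y) := by
  rw [seg_eq_image]
  exact isCompact_Icc.image (T.continuous_path x y)

/-- Two geodesics that concatenate to a path of minimal length form a geodesic, so uniqueness of
geodesics makes `c` a point of the geodesic from `x` to `y`. -/
theorem path_dist_of_dist_add_dist (T : MeasuredTree) {x y c : T.V}
    (h : dist x c + dist c y = dist x y) : T.path x y (dist x c) = c := by
  set f : Icc (0 : ℝ) (dist x y) → T.V := fun t =>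
    if (t : ℝ) ≤ dist x c then T.path x c t else T.path c y (t - dist x c) with hf
  have hlt : ∀ s t : Icc (0 : ℝ) (dist x y), (s : ℝ) ≤ t → dist (f s) (f t) = t - s := by
    intro s t hst
    have hs0 := s.2.1
    have ht1 := t.2.2
    simp only [hf]
    split_ifs with h1 h2 h2
    · rw [T.dist_path_path x c ⟨hs0, h1⟩ ⟨hs0.trans hst, h2⟩, abs_sub_comm,
        abs_of_nonneg (sub_nonneg.2 hst)]
    · push Not at h2
      have hs : (s : ℝ) ∈ Icc 0 (dist x c) := ⟨hs0, h1⟩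
      have ht : (t : ℝ) - dist x c ∈ Icc 0 (dist c y) := ⟨by linarith, by linarith⟩
      have e1 := T.dist_left_path x c hs
      have e2 := T.dist_path_right x c hs
      have e3 := T.dist_left_path c y ht
      have e4 := T.dist_path_right c y ht
      have i1 := dist_triangle (T.path x c s) c (T.path c y (t - dist x c))
      have i2 := dist_triangle4 x (T.path x c s) (T.path c y (t - dist x c)) y
      linarith
    · linarith
    · rw [T.dist_path_path c y ⟨by linarith, by linarith⟩ ⟨by linarith, by linarith⟩,
        abs_sub_comm, abs_of_nonneg (by linarith)]
      ring
  have hiso : Isometry f := by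
    refine Isometry.of_dist_eq fun s t => ?_
    rw [Subtype.dist_eq, Real.dist_eq]
    rcases le_total (s : ℝ) t with hst | hst
    · rw [hlt s t hst, abs_sub_comm, abs_of_nonneg (sub_nonneg.2 hst)]
    · rw [dist_comm, hlt t s hst, abs_of_nonneg (sub_nonneg.2 hst)]
  have h0 : f ⟨0, left_mem_Icc.2 dist_nonneg⟩ = x := by
    simp only [hf, dist_nonneg, if_true]
    exact T.path_zero x c
  have h1 : f ⟨dist x y, right_mem_Icc.2 dist_nonneg⟩ = y := by
    simp only [hf]
    split_ifs with h'
    · have hcy : c = y := dist_le_zero.1 (by linarith)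
      subst hcy
      exact T.path_dist x c
    · rw [← h, add_sub_cancel_left, path_dist]
  have hfg : f = T.geod x y :=
    (T.isRTree.geodesic x y).unique ⟨hiso, h0, h1⟩ (T.isRTree.geodesic x y).choose_spec.1
  have hc : dist x c ∈ Icc 0 (dist x y) := ⟨dist_nonneg, by linarith [dist_nonneg (x := c) (y := y)]⟩
  rw [path_of_mem _ _ _ hc, ← hfg]
  simp only [hf, le_refl, if_true]
  exact T.path_dist x c

theorem mem_seg_iff (T : MeasuredTree) {x y c : T.V} :
    c ∈ T.seg x y ↔ dist x c + dist c y = dist x y := by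
  rw [seg_eq_image]
  constructor
  · rintro ⟨t, ht, rfl⟩
    rw [T.dist_left_path x y ht, T.dist_path_right x y ht]
    ring
  · intro h
    exact ⟨dist x c, ⟨dist_nonneg, by linarith [dist_nonneg (x := c) (y := y)]⟩,
      T.path_dist_of_dist_add_dist h⟩

theorem seg_comm (T : MeasuredTree) (x y : T.V) : T.seg x y = T.seg y x := by
  ext c
  rw [mem_seg_iff, mem_seg_iff, dist_comm x c, dist_comm c y, dist_comm x y, add_comm]

theorem path_mem_seg (T : MeasuredTree) (x y : T.V) {t : ℝ} (ht : t ∈ Icc 0 (dist x y)) :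
    T.path x y t ∈ T.seg x y := by
  rw [seg_eq_image]
  exact mem_image_of_mem _ ht

theorem mem_segHalfOpen_iff (T : MeasuredTree) {x y c : T.V} :
    c ∈ T.segHalfOpen x y ↔ c ∈ T.seg x y ∧ c ≠ y := by
  constructor
  · rintro ⟨t, ht, rfl⟩
    refine ⟨mem_range_self t, fun h => ?_⟩
    have := T.dist_path_right x y t.2
    rw [T.path_of_mem x y t.2, h, dist_self] at this
    have ht' : (t : ℝ) < dist x y := ht
    linarith
  · rintro ⟨⟨t, rfl⟩, hc⟩
    refine ⟨t, lt_of_le_of_ne t.2.2 fun h => hc ?_, rfl⟩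
    exact (T.path_of_mem x y t.2).symm.trans (by rw [h, path_dist])

theorem mem_segOpen_iff (T : MeasuredTree) {x y c : T.V} :
    c ∈ T.segOpen x y ↔ c ∈ T.seg x y ∧ c ≠ x ∧ c ≠ y := by
  constructor
  · rintro ⟨t, ⟨ht0, ht⟩, rfl⟩
    refine ⟨mem_range_self t, fun h => ?_, (T.mem_segHalfOpen_iff.1 ⟨t, ht, rfl⟩).2⟩
    have := T.dist_left_path x y t.2
    rw [T.path_of_mem x y t.2, h, dist_self] at this
    exact (ne_of_lt ht0) this
  · rintro ⟨hc, hx, hy⟩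
    obtain ⟨t, ht, rfl⟩ := T.mem_segHalfOpen_iff.2 ⟨hc, hy⟩
    refine ⟨t, ⟨lt_of_le_of_ne t.2.1 fun h => hx ?_, ht⟩, rfl⟩
    exact (T.path_of_mem x y t.2).symm.trans (by rw [← h, path_zero])

/-! ### Medians and the skeleton -/

/-- Any three points have a median: the first point `p` of `⟦x, y⟦` met on the way from `z` to `x`.
The path from `z` to `p` followed by `⟦p, y⟧` is injective, so by the absence of loops it runs
through the geodesic from `z` to `y`. -/
theorem exists_median (T : MeasuredTree) (x y z : T.V) :
    ∃ p, dist x p + dist p y = dist x y ∧ dist x p + dist p z = dist x z ∧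
      dist y p + dist p z = dist y z := by
  by_cases hz : z ∈ T.seg x y
  · refine ⟨z, T.mem_seg_iff.1 hz, by simp, by simp⟩
  set S : Set ℝ := Icc 0 (dist z x) ∩ T.path z x ⁻¹' T.seg x y with hS
  have hSc : IsCompact S :=
    isCompact_Icc.inter_right ((T.isCompact_seg x y).isClosed.preimage (T.continuous_path z x))
  have hSn : S.Nonempty := ⟨dist z x, right_mem_Icc.2 dist_nonneg, by
    rw [mem_preimage, path_dist, mem_seg_iff]; simp⟩
  obtain ⟨t₀, ⟨ht₀, hp⟩, hmin⟩ := hSc.exists_isLeast hSn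
  set p := T.path z x t₀ with hpdef
  have hp' := T.mem_seg_iff.1 hp
  have hzp : dist z p = t₀ := T.dist_left_path z x ht₀
  have hpx : dist p x = dist z x - t₀ := T.dist_path_right z x ht₀
  have hlt : ∀ t, 0 ≤ t → t < t₀ → T.path z x t ∉ T.seg x y := fun t h0 h1 hm =>
    absurd (hmin ⟨⟨h0, h1.le.trans ht₀.2⟩, hm⟩) (not_le.2 h1)
  have ht₀pos : 0 < t₀ := by
    refine lt_of_le_of_ne ht₀.1 fun h => hz ?_
    have : p = z := by rw [hpdef, ← h, path_zero]
    rwa [← this]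
  have hsub : ∀ t ∈ Icc 0 (dist p y), T.path p y t ∈ T.seg x y := by
    intro t ht
    rw [mem_seg_iff]
    have e1 := T.dist_left_path p y ht
    have e2 := T.dist_path_right p y ht
    have i1 := dist_triangle x p (T.path p y t)
    have i2 := dist_triangle x (T.path p y t) y
    linarith
  have hzy : 0 < dist z y := dist_pos.2 fun h => hz (by rw [h, mem_seg_iff]; simp)
  set M := t₀ + dist p y with hM
  have hMpos : 0 < M := by positivity
  set q : Icc (0 : ℝ) 1 → T.V := fun s =>
    if (s : ℝ) * M ≤ t₀ then T.path z x (s * M) else T.path p y (s * M - t₀) with hq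
  have hqc : Continuous q := by
    refine Continuous.if_le ?_ ?_ (by fun_prop) continuous_const ?_
    · exact (T.continuous_path z x).comp (by fun_prop)
    · exact (T.continuous_path p y).comp (by fun_prop)
    · intro s hs
      rw [hs, sub_self, path_zero]
  have hs0 : ∀ s : Icc (0 : ℝ) 1, 0 ≤ (s : ℝ) * M := fun s => mul_nonneg s.2.1 hMpos.le
  have hs1 : ∀ s : Icc (0 : ℝ) 1, (s : ℝ) * M ≤ M := fun s =>
    mul_le_of_le_one_left hMpos.le s.2.2
  have hcross : ∀ s t : Icc (0 : ℝ) 1, (s : ℝ) * M ≤ t₀ → ¬ (t : ℝ) * M ≤ t₀ →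
      T.path z x (s * M) ≠ T.path p y (t * M - t₀) := by
    intro s t h1 h2 h
    push Not at h2
    have ht : (t : ℝ) * M - t₀ ∈ Icc 0 (dist p y) := ⟨by linarith, by linarith [hs1 t]⟩
    rcases h1.lt_or_eq with h1 | h1
    · exact hlt _ (hs0 s) h1 (h ▸ hsub _ ht)
    · rw [h1, ← hpdef] at h
      have := T.dist_left_path p y ht
      rw [← h, dist_self] at this
      linarith
  have hqi : Function.Injective q := by
    intro s t hst
    have key : (s : ℝ) * M = t * M := by
      simp only [hq] at hst
      split_ifs at hst with h1 h2 h2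
      · exact T.injOn_path z x ⟨hs0 s, h1.trans ht₀.2⟩ ⟨hs0 t, h2.trans ht₀.2⟩ hst
      · exact absurd hst (hcross s t h1 h2)
      · exact absurd hst.symm (hcross t s h2 h1)
      · push Not at h1 h2
        have := T.injOn_path p y ⟨by linarith, by linarith [hs1 s]⟩
          ⟨by linarith, by linarith [hs1 t]⟩ hst
        linarith
    exact Subtype.ext (mul_right_cancel₀ hMpos.ne' key)
  set r : Icc (0 : ℝ) 1 → T.V := fun s => T.path z y (s * dist z y) with hr
  have hrm : ∀ s : Icc (0 : ℝ) 1, (s : ℝ) * dist z y ∈ Icc 0 (dist z y) := fun s =>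
    ⟨mul_nonneg s.2.1 hzy.le, mul_le_of_le_one_left hzy.le s.2.2⟩
  have hrc : Continuous r := (T.continuous_path z y).comp (by fun_prop)
  have hri : Function.Injective r := fun s t hst =>
    Subtype.ext (mul_right_cancel₀ hzy.ne' (T.injOn_path z y (hrm s) (hrm t) hst))
  have hq0 : q 0 = z := by simp [hq, ht₀pos.le, path_zero]
  have hq1 : q 1 = y := by
    simp only [hq, Set.Icc.coe_one, one_mul]
    split_ifs with h
    · have hpy : p = y := dist_le_zero.1 (by linarith)
      have : M = t₀ := by rw [hM, hpy]; simp
      rw [this, ← hpdef, hpy]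
    · rw [hM, add_sub_cancel_left, path_dist]
  have hr0 : r 0 = z := by simp [hr, path_zero]
  have hr1 : r 1 = y := by simp [hr, path_dist]
  have hpq : p ∈ range q := by
    refine ⟨⟨t₀ / M, by positivity, ?_⟩, ?_⟩
    · rw [div_le_one hMpos]
      linarith [dist_nonneg (x := p) (y := y)]
    · simp only [hq, div_mul_cancel₀ _ hMpos.ne', le_refl, if_true, ← hpdef]
  rw [T.isRTree.noLoop z y q r hqc hqi hrc hri hq0 hq1 hr0 hr1] at hpq
  obtain ⟨s, hs⟩ := hpq
  have hpzy : p ∈ T.seg z y := hs ▸ T.path_mem_seg z y (hrm s)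
  have hpzy' := T.mem_seg_iff.1 hpzy
  refine ⟨p, hp', ?_, ?_⟩
  · rw [dist_comm x p, dist_comm p z, dist_comm x z]; linarith
  · rw [dist_comm y p, dist_comm p z, dist_comm y z]; linarith

theorem seg_subset_union (T : MeasuredTree) (o a b : T.V) :
    T.seg a b ⊆ T.seg o a ∪ T.seg o b := by
  intro c hc
  obtain ⟨p, h1, h2, h3⟩ := T.exists_median a b o
  have hp := T.path_dist_of_dist_add_dist h1
  have hc' := T.path_dist_of_dist_add_dist (T.mem_seg_iff.1 hc)
  have hcab := T.mem_seg_iff.1 hc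
  have hcp : dist c p = |dist a c - dist a p| := by
    conv_lhs => rw [← hp, ← hc']
    exact T.dist_path_path a b
      ⟨dist_nonneg, by linarith [dist_nonneg (x := c) (y := b)]⟩
      ⟨dist_nonneg, by linarith [dist_nonneg (x := p) (y := b)]⟩
  have i1 := dist_triangle c p o
  rcases le_total (dist a c) (dist a p) with h | h
  · left
    rw [abs_of_nonpos (by linarith)] at hcp
    have i2 := dist_triangle a c o
    rw [mem_seg_iff, dist_comm o c, dist_comm c a, dist_comm o a]
    linarith
  · right
    rw [abs_of_nonneg (by linarith)] at hcp
    have i2 := dist_triangle b c o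
    rw [dist_comm b c] at i2
    rw [dist_comm b p, dist_comm b o] at h3
    rw [dist_comm b o] at i2
    rw [mem_seg_iff, dist_comm o c]
    linarith

theorem segOpen_subset_skeleton (T : MeasuredTree) (a b : T.V) : T.segOpen a b ⊆ T.skeleton := by
  intro c hc
  obtain ⟨hc, ha, hb⟩ := T.mem_segOpen_iff.1 hc
  rcases T.seg_subset_union T.root a b hc with h | h
  · exact mem_iUnion.2 ⟨a, T.mem_segHalfOpen_iff.2 ⟨h, ha⟩⟩
  · exact mem_iUnion.2 ⟨b, T.mem_segHalfOpen_iff.2 ⟨h, hb⟩⟩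

theorem measurableSet_segHalfOpen (T : MeasuredTree) (a b : T.V) :
    MeasurableSet (T.segHalfOpen a b) := by
  have : T.segHalfOpen a b = T.seg a b \ {b} := by
    ext c
    rw [mem_segHalfOpen_iff]
    rfl
  rw [this]
  exact (T.isCompact_seg a b).measurableSet.diff (measurableSet_singleton b)

theorem measurableSet_segOpen (T : MeasuredTree) (a b : T.V) : MeasurableSet (T.segOpen a b) := by
  have : T.segOpen a b = T.seg a b \ {a, b} := by
    ext c
    rw [mem_segOpen_iff]
    simp
  rw [this]
  exact (T.isCompact_seg a b).measurableSet.diff (Set.toFinite _).measurableSet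

/-- Half-open segments towards a dense set of points exhaust the skeleton: a point `c ≠ x` of
`⟦root, x⟧` also lies on `⟦root, x'⟧` once `x'` is closer to `x` than `c` is. -/
theorem skeleton_eq_iUnion (T : MeasuredTree) {u : ℕ → T.V} (hu : DenseRange u) :
    T.skeleton = ⋃ n, T.segHalfOpen T.root (u n) := by
  refine Subset.antisymm (iUnion_subset fun x c hc => ?_)
    (iUnion_subset fun n => subset_iUnion (fun x => T.segHalfOpen T.root x) (u n))
  obtain ⟨hc, hne⟩ := T.mem_segHalfOpen_iff.1 hc
  obtain ⟨n, hn⟩ := hu.exists_dist_lt x (dist_pos.2 hne.symm)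
  refine mem_iUnion.2
    ⟨n, T.mem_segHalfOpen_iff.2 ⟨?_, fun h => by rw [h] at hn; exact lt_irrefl _ hn⟩⟩
  have hc' : c ∈ T.seg x T.root := by
    rwa [seg_comm]
  rcases T.seg_subset_union (u n) x T.root hc' with h | h
  · have := T.mem_seg_iff.1 h
    rw [dist_comm (u n) x, dist_comm c x] at this
    linarith [dist_nonneg (x := u n) (y := c)]
  · rwa [seg_comm]

/-! ### The length measure -/

theorem hausdorffMeasure_image_path (T : MeasuredTree) (x y : T.V) {S : Set ℝ}
    (hS : S ⊆ Icc 0 (dist x y)) : μH[1] (T.path x y '' S) = volume S := by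
  have h1 : T.path x y '' S = T.geod x y '' (Subtype.val ⁻¹' S) := by
    ext c
    constructor
    · rintro ⟨t, ht, rfl⟩
      exact ⟨⟨t, hS ht⟩, ht, (T.path_of_mem x y (hS ht)).symm⟩
    · rintro ⟨t, ht, rfl⟩
      exact ⟨t, ht, T.path_of_mem x y t.2⟩
  rw [h1, (T.geod_isometry x y).hausdorffMeasure_image (Or.inl zero_le_one),
    ← (isometry_subtype_coe (s := Icc 0 (dist x y))).hausdorffMeasure_image (Or.inl zero_le_one),
    Subtype.image_preimage_coe, inter_eq_right.2 hS, hausdorffMeasure_real]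

theorem segOpen_eq_image (T : MeasuredTree) (x y : T.V) :
    T.segOpen x y = T.path x y '' Ioo 0 (dist x y) := by
  ext c
  constructor
  · rintro ⟨t, ht, rfl⟩
    exact ⟨t, ht, T.path_of_mem x y t.2⟩
  · rintro ⟨t, ht, rfl⟩
    exact ⟨⟨t, Ioo_subset_Icc_self ht⟩, ht, (T.path_of_mem x y (Ioo_subset_Icc_self ht)).symm⟩

theorem hausdorffMeasure_segOpen (T : MeasuredTree) (x y : T.V) :
    μH[1] (T.segOpen x y) = ENNReal.ofReal (dist x y) := by
  rw [segOpen_eq_image, hausdorffMeasure_image_path _ _ _ Ioo_subset_Icc_self, Real.volume_Ioo,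
    sub_zero]

theorem segOpen_path_path (T : MeasuredTree) (x y : T.V) {s t : ℝ} (hs : 0 ≤ s) (hst : s ≤ t)
    (ht : t ≤ dist x y) :
    T.segOpen (T.path x y s) (T.path x y t) = T.path x y '' Ioo s t := by
  have hs' : s ∈ Icc 0 (dist x y) := ⟨hs, hst.trans ht⟩
  have ht' : t ∈ Icc 0 (dist x y) := ⟨hs.trans hst, ht⟩
  have hd : dist (T.path x y s) (T.path x y t) = t - s := by
    rw [T.dist_path_path x y hs' ht', abs_sub_comm, abs_of_nonneg (sub_nonneg.2 hst)]
  ext c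
  rw [mem_segOpen_iff, mem_seg_iff, hd]
  constructor
  · rintro ⟨h, hcs, hct⟩
    have e1 := T.dist_left_path x y hs'
    have e2 := T.dist_path_right x y ht'
    have i1 := dist_triangle x (T.path x y s) c
    have i2 := dist_triangle c (T.path x y t) y
    have i3 := dist_triangle x c y
    have p1 := dist_pos.2 hcs.symm
    have p2 := dist_pos.2 hct
    exact ⟨dist x c, ⟨by linarith, by linarith⟩, T.path_dist_of_dist_add_dist (by linarith)⟩
  · rintro ⟨u, hu, rfl⟩
    have hu' : u ∈ Icc 0 (dist x y) := ⟨hs.trans hu.1.le, hu.2.le.trans ht⟩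
    refine ⟨?_, fun h => hu.1.ne' (T.injOn_path x y hu' hs' h),
      fun h => hu.2.ne (T.injOn_path x y hu' ht' h)⟩
    rw [T.dist_path_path x y hs' hu', T.dist_path_path x y hu' ht', abs_sub_comm,
      abs_of_pos (sub_pos.2 hu.1), abs_sub_comm, abs_of_pos (sub_pos.2 hu.2)]
    ring

/-- Along a segment, the length measure is Lebesgue measure of the distance to the starting
point. -/
theorem IsLengthMeasure.segOpen_inter_preimage {T : MeasuredTree} {ℓ : Measure T.V}
    (hℓ : T.IsLengthMeasure ℓ) (x y : T.V) {C : Set ℝ} (hC : MeasurableSet C) :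
    ℓ (dist x ⁻¹' C ∩ T.segOpen x y) = volume (C ∩ Ioo 0 (dist x y)) := by
  have hm : Measurable (dist x) := (continuous_const.dist continuous_id).measurable
  have hfin : IsFiniteMeasure (ℓ.restrict (T.segOpen x y)) :=
    ⟨by rw [Measure.restrict_apply_univ, hℓ.segOpen]; exact ENNReal.ofReal_lt_top⟩
  have key : (ℓ.restrict (T.segOpen x y)).map (dist x) =
      volume.restrict (Ioo 0 (dist x y)) := by
    refine Real.measure_ext_Ioo_rat fun p q => ?_
    rw [Measure.map_apply hm measurableSet_Ioo,
      Measure.restrict_apply (hm measurableSet_Ioo), Measure.restrict_apply measurableSet_Ioo,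
      Ioo_inter_Ioo, Real.volume_Ioo]
    set s : ℝ := (p : ℝ) ⊔ 0
    set t : ℝ := (q : ℝ) ⊓ dist x y
    have himg : dist x ⁻¹' Ioo (p : ℝ) q ∩ T.segOpen x y = T.path x y '' Ioo s t := by
      rw [← Ioo_inter_Ioo, segOpen_eq_image]
      ext c
      constructor
      · rintro ⟨h1, u, hu, rfl⟩
        rw [mem_preimage, T.dist_left_path x y (Ioo_subset_Icc_self hu)] at h1
        exact ⟨u, ⟨h1, hu⟩, rfl⟩
      · rintro ⟨u, ⟨h1, hu⟩, rfl⟩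
        refine ⟨?_, u, hu, rfl⟩
        rwa [mem_preimage, T.dist_left_path x y (Ioo_subset_Icc_self hu)]
    rw [himg]
    rcases le_total s t with hst | hst
    · have hs : 0 ≤ s := le_sup_right
      have ht : t ≤ dist x y := inf_le_right
      rw [← T.segOpen_path_path x y hs hst ht, hℓ.segOpen, T.dist_path_path x y
        ⟨hs, hst.trans ht⟩ ⟨hs.trans hst, ht⟩, abs_sub_comm, abs_of_nonneg (sub_nonneg.2 hst)]
    · rw [Ioo_eq_empty (not_lt.2 hst), image_empty, measure_empty,
        ENNReal.ofReal_of_nonpos (sub_nonpos.2 hst)]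
  rw [← Measure.restrict_apply hC, ← key, Measure.map_apply hm hC, Measure.restrict_apply (hm hC)]

theorem sigmaFinite (T : MeasuredTree) : SigmaFinite T.μ := by
  refine ⟨⟨⟨fun n : ℕ => Metric.closedBall T.root n, fun _ => trivial, fun n =>
    T.boundedlyFinite _ Metric.isBounded_closedBall Metric.isClosed_closedBall.measurableSet, ?_⟩⟩⟩
  exact Metric.iUnion_closedBall_nat T.root

/-- The length measure is one-dimensional Hausdorff measure on the skeleton. It is dominated by `μ`
as soon as `μ` gives enough mass to the compact subsets of segments from the root. -/
theorem dominatesLength_of_volume_le (T : MeasuredTree) [TopologicalSpace.SeparableSpace T.V]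
    (h : ∀ x : T.V, ∀ C ⊆ Icc 0 (dist T.root x), IsCompact C →
      volume C ≤ T.μ (T.path T.root x '' C)) : T.DominatesLength := by
  have : Nonempty T.V := ⟨T.root⟩
  have hseg : ∀ (x : T.V) (A : Set T.V), MeasurableSet A → A ⊆ T.seg T.root x →
      μH[1] A ≤ T.μ A := by
    intro x A hA hAx
    have himg : T.path T.root x '' (T.path T.root x ⁻¹' A ∩ Icc 0 (dist T.root x)) = A := by
      rw [image_preimage_inter, ← seg_eq_image, inter_eq_left.2 hAx]
    rw [← himg, hausdorffMeasure_image_path _ _ _ inter_subset_right, himg]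
    refine le_of_forall_lt fun c hc => ?_
    obtain ⟨K, hK, hKc, hcK⟩ := MeasurableSet.exists_lt_isCompact
      (((T.continuous_path T.root x).measurable hA).inter measurableSet_Icc) hc
    refine hcK.trans_le ((h x K (hK.trans inter_subset_right) hKc).trans (measure_mono ?_))
    rintro _ ⟨t, ht, rfl⟩
    exact (hK ht).1
  set u := TopologicalSpace.denseSeq T.V
  set J : ℕ → Set T.V := fun n => T.segHalfOpen T.root (u n)
  have hskel : T.skeleton = ⋃ n, J n :=
    T.skeleton_eq_iUnion (TopologicalSpace.denseRange_denseSeq T.V)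
  have hJm : ∀ n, MeasurableSet (J n) := fun n => T.measurableSet_segHalfOpen _ _
  have hsm : MeasurableSet T.skeleton := hskel ▸ MeasurableSet.iUnion hJm
  have hle : (μH[1] : Measure T.V).restrict T.skeleton ≤ T.μ := by
    refine Measure.le_iff.2 fun A hA => ?_
    have hDm : ∀ n, MeasurableSet (A ∩ disjointed J n) := fun n =>
      hA.inter (MeasurableSet.disjointed hJm n)
    rw [Measure.restrict_apply hA, hskel, ← iUnion_disjointed, inter_iUnion]
    calc μH[1] (⋃ n, A ∩ disjointed J n) ≤ ∑' n, μH[1] (A ∩ disjointed J n) :=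
          measure_iUnion_le _
      _ ≤ ∑' n, T.μ (A ∩ disjointed J n) := ENNReal.tsum_le_tsum fun n =>
          hseg (u n) _ (hDm n) fun c hc =>
            (T.mem_segHalfOpen_iff.1 (disjointed_subset J n hc.2)).1
      _ = T.μ (⋃ n, A ∩ disjointed J n) :=
          (measure_iUnion (fun m n hmn => ((disjoint_disjointed J) hmn).mono inter_subset_right
            inter_subset_right) hDm).symm
      _ ≤ T.μ A := measure_mono (iUnion_subset fun n => inter_subset_left)
  have := T.sigmaFinite
  refine ⟨(μH[1] : Measure T.V).restrict T.skeleton,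
    ⟨Measure.sigmaFinite_of_le T.μ hle, fun a b => ?_, ?_⟩, hle⟩
  · rw [Measure.restrict_apply (T.measurableSet_segOpen a b),
      inter_eq_left.2 (T.segOpen_subset_skeleton a b), hausdorffMeasure_segOpen]
  · rw [Measure.restrict_apply hsm.compl, compl_inter_self, measure_empty]

theorem Equivalent.dominatesLength {T T' : MeasuredTree} (h : Equivalent T T')
    (hT : T.DominatesLength) : T'.DominatesLength := by
  obtain ⟨e, he, hμ⟩ := h
  obtain ⟨ℓ, hℓ, hle⟩ := hT
  have hm : Measurable e := e.continuous.measurable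
  have hsigma := hℓ.sigmaFinite
  have hE : MeasurableEmbedding e := e.toHomeomorph.measurableEmbedding
  refine ⟨ℓ.map e, ⟨?_, fun a b => ?_, ?_⟩, hμ ▸ Measure.map_mono hle hm⟩
  · exact (e.toHomeomorph.toMeasurableEquiv).sigmaFinite_map
  · obtain ⟨a, rfl⟩ := e.surjective a
    obtain ⟨b, rfl⟩ := e.surjective b
    rw [hE.map_apply, e.dist_eq, ← hℓ.segOpen]
    congr 1
    ext c
    simp only [mem_preimage, mem_segOpen_iff, mem_seg_iff, e.dist_eq, e.injective.ne_iff]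
  · rw [hE.map_apply, ← hℓ.compl_skeleton]
    congr 1
    ext c
    rw [mem_preimage, mem_compl_iff, mem_compl_iff, not_iff_not, skeleton, skeleton, mem_iUnion,
      mem_iUnion, e.surjective.exists]
    simp only [mem_segHalfOpen_iff, mem_seg_iff, ← he, e.dist_eq, e.injective.ne_iff]

/-! ### Comparison of trees with close balls -/

/-- Isometric embeddings of balls of two trees into a common space that match the roots, the points
`x`, `x'` and all of one ball up to `δ` also match the geodesics from the roots to `x`, `x'`. A point
approximating `a` has almost minimal total distance to the root and `x'`; its projection to
`⟦root, x'⟧` therefore lies close both to it and to the point of that segment at height `t`. -/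
theorem dist_path_path_le {T T' : MeasuredTree} {r : ℝ≥0} {Z : Type} [MetricSpace Z]
    {φ : T.ball r → Z} {ψ : T'.ball r → Z} (hφ : Isometry φ) (hψ : Isometry ψ) {δ : ℝ}
    (hroot : dist (φ (T.ballRoot r)) (ψ (T'.ballRoot r)) ≤ δ)
    (hnear : ∀ a, ∃ b, dist (φ a) (ψ b) ≤ δ) {x : T.ball r} {x' : T'.ball r}
    (hx : dist (φ x) (ψ x') ≤ δ) {t : ℝ} (ht : t ∈ Icc 0 (dist T.root x))
    (ht' : t ∈ Icc 0 (dist T'.root x')) {a : T.ball r} (ha : a = T.path T.root x t)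
    {b : T'.ball r} (hb : b = T'.path T'.root x' t) : dist (φ a) (ψ b) ≤ 8 * δ := by
  obtain ⟨y, hy⟩ := hnear a
  have dφ : ∀ p q : T.ball r, dist (φ p) (φ q) = dist (p : T.V) q := fun p q => hφ.dist_eq p q
  have dψ : ∀ p q : T'.ball r, dist (ψ p) (ψ q) = dist (p : T'.V) q := fun p q => hψ.dist_eq p q
  have e1 : dist (φ (T.ballRoot r)) (φ a) = t := by
    rw [dφ, ha]; exact T.dist_left_path _ _ ht
  have e2 : dist (φ a) (φ x) = dist T.root x - t := by
    rw [dφ, ha]; exact T.dist_path_right _ _ ht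
  have e3 : dist (φ (T.ballRoot r)) (φ x) = dist T.root x := dφ _ _
  have f1 : dist (ψ (T'.ballRoot r)) (ψ y) = dist T'.root y := dψ _ _
  have f2 : dist (ψ y) (ψ x') = dist (y : T'.V) x' := dψ _ _
  have f3 : dist (ψ (T'.ballRoot r)) (ψ x') = dist T'.root x' := dψ _ _
  have f4 : dist (ψ y) (ψ b) = dist (y : T'.V) b := dψ _ _
  have hroot' := hroot
  rw [dist_comm] at hroot'
  have hx' := hx
  have hy' := hy
  rw [dist_comm] at hx' hy'
  have i1 := dist_triangle4 (φ (T.ballRoot r)) (ψ (T'.ballRoot r)) (ψ x') (φ x)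
  have i2 := dist_triangle4 (ψ (T'.ballRoot r)) (φ (T.ballRoot r)) (φ a) (ψ y)
  have i3 := dist_triangle4 (ψ y) (φ a) (φ x) (ψ x')
  obtain ⟨p, h1, h2, h3⟩ := T'.exists_median T'.root x' y
  have hp := T'.path_dist_of_dist_add_dist h1
  have hpb : dist p (b : T'.V) = |dist T'.root p - t| := by
    conv_lhs => rw [← hp, hb]
    exact T'.dist_path_path _ _
      ⟨dist_nonneg, by linarith [dist_nonneg (x := p) (y := (x' : T'.V))]⟩ ht'
  rw [dist_comm (x' : T'.V) p, dist_comm (x' : T'.V) y] at h3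
  have i4 := dist_triangle (y : T'.V) p b
  rw [dist_comm (y : T'.V) p] at i4
  have i5 := dist_triangle (φ a) (ψ y) (ψ b)
  have hC : 0 ≤ dist p (y : T'.V) := dist_nonneg
  have hδ : 0 ≤ δ := dist_nonneg.trans hroot
  have habs : |dist T'.root p - t| ≤ 4 * δ := abs_le.2 ⟨by linarith, by linarith⟩
  linarith

/-- The mass of compact subsets of segments, up to an error that vanishes as the balls of the two
trees get close. -/
theorem volume_le_measure_thickening_add {T T' : MeasuredTree} (hT' : T'.DominatesLength) {r : ℝ≥0}
    {δ : ℝ} (hδ : 0 < δ)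
    (hdist : ghpcDist (T.ballRoot r) (T.ballMeasure r) (T'.ballRoot r) (T'.ballMeasure r) <
      ENNReal.ofReal δ) {x : T.V} (hxr : dist T.root x ≤ r) {C : Set ℝ}
    (hC : C ⊆ Icc 0 (dist T.root x)) (hCm : MeasurableSet C) :
    volume C ≤ T.μ (Metric.thickening (10 * δ) (T.path T.root x '' C)) + ENNReal.ofReal (3 * δ) := by
  simp only [ghpcDist, iInf_lt_iff] at hdist
  obtain ⟨Z, _, _, _, _, _, φ, ψ, hφ, hψ, hlt⟩ := hdist
  have hroot : edist (φ (T.ballRoot r)) (ψ (T'.ballRoot r)) < ENNReal.ofReal δ :=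
    (le_self_add.trans le_self_add).trans_lt hlt
  have hhaus : Metric.hausdorffEDist (range φ) (range ψ) < ENNReal.ofReal δ :=
    (le_add_self.trans le_self_add).trans_lt hlt
  have hprok : levyProkhorovEDist ((T.ballMeasure r).map φ) ((T'.ballMeasure r).map ψ) <
      ENNReal.ofReal δ := le_add_self.trans_lt hlt
  have hroot' : dist (φ (T.ballRoot r)) (ψ (T'.ballRoot r)) ≤ δ :=
    (edist_lt_ofReal.1 hroot).le
  have hnear : ∀ a, ∃ b, dist (φ a) (ψ b) ≤ δ := fun a => by
    obtain ⟨_, ⟨b, rfl⟩, hb⟩ :=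
      Metric.exists_edist_lt_of_hausdorffEDist_lt (mem_range_self a) hhaus
    exact ⟨b, (edist_lt_ofReal.1 hb).le⟩
  have hxb : x ∈ Metric.closedBall T.root (r : ℝ) := by rwa [Metric.mem_closedBall, dist_comm]
  obtain ⟨x', hx'⟩ := hnear ⟨x, hxb⟩
  have hx'r : dist T'.root x' ≤ r := by
    rw [dist_comm]; exact Metric.mem_closedBall.1 x'.2
  -- the heights of `x` and `x'` differ by at most `2 * δ`
  have hL : dist T.root x ≤ dist T'.root x' + 2 * δ := by
    have e1 : dist (φ (T.ballRoot r)) (φ ⟨x, hxb⟩) = dist T.root x := hφ.dist_eq _ _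
    have e2 : dist (ψ (T'.ballRoot r)) (ψ x') = dist T'.root x' := hψ.dist_eq _ _
    have i := dist_triangle4 (φ (T.ballRoot r)) (ψ (T'.ballRoot r)) (ψ x') (φ ⟨x, hxb⟩)
    rw [dist_comm (ψ x')] at i
    linarith
  set L := dist T.root x with hLdef
  set L' := dist T'.root x' with hL'def
  set K := T.path T.root x '' C with hK
  set B : Set Z := Metric.thickening (9 * δ) (φ '' (Subtype.val ⁻¹' K)) with hB
  have hBm : MeasurableSet B := Metric.isOpen_thickening.measurableSet
  have hvE : MeasurableEmbedding (Subtype.val : T.ball r → T.V) :=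
    MeasurableEmbedding.subtype_coe Metric.isClosed_closedBall.measurableSet
  have hvE' : MeasurableEmbedding (Subtype.val : T'.ball r → T'.V) :=
    MeasurableEmbedding.subtype_coe Metric.isClosed_closedBall.measurableSet
  obtain ⟨ℓ, hℓ, hle⟩ := hT'
  have h1 : volume (C ∩ Ioo 0 L') ≤ (T'.ballMeasure r).map ψ B := by
    rw [Measure.map_apply hψ.continuous.measurable hBm, ballMeasure, hvE'.comap_apply,
      ← hℓ.segOpen_inter_preimage T'.root x' hCm]
    refine (hle _).trans (measure_mono ?_)
    rw [segOpen_eq_image]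
    rintro _ ⟨htC, t, ht, rfl⟩
    have ht' := Ioo_subset_Icc_self ht
    rw [mem_preimage, T'.dist_left_path _ _ ht'] at htC
    have htL := hC htC
    have hbr : T'.path T'.root x' t ∈ Metric.closedBall T'.root (r : ℝ) := by
      rw [Metric.mem_closedBall, dist_comm, T'.dist_left_path _ _ ht']
      exact ht'.2.trans hx'r
    have har : T.path T.root x t ∈ Metric.closedBall T.root (r : ℝ) := by
      rw [Metric.mem_closedBall, dist_comm, T.dist_left_path _ _ htL]
      exact htL.2.trans hxr
    refine ⟨⟨_, hbr⟩, Metric.mem_thickening_iff.2 ⟨φ ⟨_, har⟩,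
      mem_image_of_mem _ (mem_image_of_mem _ htC), ?_⟩, rfl⟩
    have := dist_path_path_le hφ hψ hroot' hnear (x := ⟨x, hxb⟩) hx' htL ht' (a := ⟨_, har⟩) rfl
      (b := ⟨_, hbr⟩) rfl
    rw [dist_comm]
    linarith
  have h2 : (T.ballMeasure r).map φ (Metric.thickening δ B) ≤
      T.μ (Metric.thickening (10 * δ) K) := by
    rw [Measure.map_apply hφ.continuous.measurable Metric.isOpen_thickening.measurableSet,
      ballMeasure, hvE.comap_apply]
    refine measure_mono ?_
    rintro _ ⟨a, ha, rfl⟩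
    have ha' := Metric.thickening_thickening_subset δ (9 * δ) _ ha
    obtain ⟨_, ⟨k, hk, rfl⟩, hak⟩ := Metric.mem_thickening_iff.1 ha'
    rw [hφ.dist_eq] at hak
    exact Metric.mem_thickening_iff.2 ⟨k, hk, hak.trans_le (by linarith)⟩
  have h3 := right_measure_le_of_levyProkhorovEDist_lt hprok hBm
  rw [ENNReal.toReal_ofReal hδ.le] at h3
  have h4 : C ⊆ C ∩ Ioo 0 L' ∪ {0} ∪ Icc L' L := by
    intro t ht
    obtain ⟨ht0, htL⟩ := hC ht
    rcases ht0.eq_or_lt with h | h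
    · exact Or.inl (Or.inr h.symm)
    · rcases lt_or_ge t L' with h' | h'
      · exact Or.inl (Or.inl ⟨ht, h, h'⟩)
      · exact Or.inr ⟨h', htL⟩
  calc volume C ≤ volume (C ∩ Ioo 0 L' ∪ {0} ∪ Icc L' L) := measure_mono h4
    _ ≤ volume (C ∩ Ioo 0 L') + volume ({0} : Set ℝ) + volume (Icc L' L) :=
        (measure_union_le _ _).trans (add_le_add_left (measure_union_le _ _) _)
    _ ≤ (T.μ (Metric.thickening (10 * δ) K) + ENNReal.ofReal δ) + 0 + ENNReal.ofReal (2 * δ) := by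
        refine add_le_add (add_le_add (h1.trans (h3.trans (add_le_add_left h2 _))) ?_) ?_
        · rw [Real.volume_singleton]
        · rw [Real.volume_Icc]
          exact ENNReal.ofReal_le_ofReal (by linarith)
    _ = T.μ (Metric.thickening (10 * δ) K) + ENNReal.ofReal (3 * δ) := by
        rw [add_zero, add_assoc, ← ENNReal.ofReal_add hδ.le (by linarith)]
        ring_nf

/-! ### Limits of trees that dominate their length measure -/

/-- The weight `exp (-r)` is bounded below on `[R, R + 1]`, so trees at small distance have close
balls of some radius in that interval. -/
theorem exists_ghpcDist_lt {T T' : MeasuredTree} {R δ : ℝ} (hR : 0 < R) (hδ1 : δ ≤ 1)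
    (h : ghpDist T T' < ENNReal.ofReal (Real.exp (-(R + 1)) * δ)) :
    ∃ r : ℝ≥0, R ≤ r ∧
      ghpcDist (T.ballRoot r) (T.ballMeasure r) (T'.ballRoot r) (T'.ballMeasure r) <
        ENNReal.ofReal δ := by
  by_contra! hcon
  refine absurd h (not_lt.2 ?_)
  have h1 : (∫⁻ _ in Icc R (R + 1), ENNReal.ofReal (Real.exp (-(R + 1)) * δ)) =
      ENNReal.ofReal (Real.exp (-(R + 1)) * δ) := by
    rw [setLIntegral_const, Real.volume_Icc]
    simp
  rw [← h1, ghpDist]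
  refine (setLIntegral_mono' measurableSet_Icc fun r hr => ?_).trans
    (lintegral_mono_set fun r hr => hR.trans_le hr.1)
  have hr0 : (r.toNNReal : ℝ) = r := Real.coe_toNNReal r (hR.le.trans hr.1)
  rw [ENNReal.ofReal_mul (Real.exp_nonneg _)]
  gcongr
  · exact hr.2
  · refine le_min ?_ (hcon _ (by rw [hr0]; exact hr.1))
    rw [← ENNReal.ofReal_one]
    exact ENNReal.ofReal_le_ofReal hδ1

theorem isSeparable_closedBall_of_ghpcDist_lt {T T' : MeasuredTree} {r : ℝ≥0} {ε : ℝ≥0∞}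
    (h : ghpcDist (T.ballRoot r) (T.ballMeasure r) (T'.ballRoot r) (T'.ballMeasure r) < ε) :
    TopologicalSpace.IsSeparable (Metric.closedBall T.root (r : ℝ)) := by
  simp only [ghpcDist, iInf_lt_iff] at h
  obtain ⟨Z, _, _, _, _, _, φ, ψ, hφ, hψ, -⟩ := h
  have := UniformSpace.secondCountable_of_separable Z
  have := hφ.isEmbedding.isInducing.secondCountableTopology
  exact TopologicalSpace.IsSeparable.of_subtype _

/-- Domination of the length measure passes to limits in the GHP distance. -/
theorem dominatesLength_of_ghpDist_lt (T : MeasuredTree)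
    (h : ∀ ε : ℝ≥0∞, 0 < ε → ∃ T' : MeasuredTree, T'.DominatesLength ∧ ghpDist T T' < ε) :
    T.DominatesLength := by
  have hclose : ∀ R δ : ℝ, 0 < R → 0 < δ → δ ≤ 1 → ∃ T' : MeasuredTree, T'.DominatesLength ∧
      ∃ r : ℝ≥0, R ≤ r ∧
        ghpcDist (T.ballRoot r) (T.ballMeasure r) (T'.ballRoot r) (T'.ballMeasure r) <
          ENNReal.ofReal δ := by
    intro R δ hR hδ hδ1
    obtain ⟨T', hT', hlt⟩ := h (ENNReal.ofReal (Real.exp (-(R + 1)) * δ))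
      (ENNReal.ofReal_pos.2 (mul_pos (Real.exp_pos _) hδ))
    exact ⟨T', hT', exists_ghpcDist_lt hR hδ1 hlt⟩
  have hsep : TopologicalSpace.SeparableSpace T.V := by
    rw [← TopologicalSpace.isSeparable_univ_iff, ← Metric.iUnion_closedBall_nat T.root]
    refine TopologicalSpace.IsSeparable.iUnion fun n => ?_
    obtain ⟨T', -, r, hr, hlt⟩ := hclose (n + 1) 1 (by positivity) one_pos le_rfl
    exact (isSeparable_closedBall_of_ghpcDist_lt hlt).mono
      (Metric.closedBall_subset_closedBall (by linarith))
  refine T.dominatesLength_of_volume_le fun x C hC hCc => ?_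
  have hKc : IsCompact (T.path T.root x '' C) := hCc.image (T.continuous_path _ _)
  have hlim : Tendsto (fun η => T.μ (Metric.thickening η (T.path T.root x '' C))) (𝓝[>] 0)
      (𝓝 (T.μ (T.path T.root x '' C))) :=
    tendsto_measure_thickening_of_isClosed ⟨1, one_pos, (T.boundedlyFinite _
      hKc.isBounded.thickening Metric.isOpen_thickening.measurableSet).ne⟩ hKc.isClosed
  have h10 : Tendsto (fun δ : ℝ => 10 * δ) (𝓝[>] 0) (𝓝[>] 0) := by
    refine tendsto_nhdsWithin_iff.2 ⟨?_, ?_⟩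
    · have : Tendsto (fun δ : ℝ => 10 * δ) (𝓝 0) (𝓝 (10 * 0)) := tendsto_id.const_mul 10
      rw [mul_zero] at this
      exact this.mono_left nhdsWithin_le_nhds
    · filter_upwards [self_mem_nhdsWithin] with δ hδ
      exact mul_pos (by norm_num : (0 : ℝ) < 10) hδ
  have h3 : Tendsto (fun δ : ℝ => ENNReal.ofReal (3 * δ)) (𝓝[>] 0) (𝓝 0) := by
    have : Tendsto (fun δ : ℝ => ENNReal.ofReal (3 * δ)) (𝓝 0) (𝓝 (ENNReal.ofReal (3 * 0))) :=
      ENNReal.tendsto_ofReal (tendsto_id.const_mul 3)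
    rw [mul_zero, ENNReal.ofReal_zero] at this
    exact this.mono_left nhdsWithin_le_nhds
  have hsum := (hlim.comp h10).add h3
  rw [add_zero] at hsum
  refine ge_of_tendsto hsum ?_
  filter_upwards [Ioc_mem_nhdsGT one_pos] with δ hδ
  obtain ⟨T', hT', r, hr, hlt⟩ := hclose (dist T.root x + 1) δ (by positivity) hδ.1 hδ.2
  exact volume_le_measure_thickening_add hT' hδ.1 hlt (by linarith) hC hCc.measurableSet

theorem finitelyManyEnds_of_compactSpace (T : MeasuredTree) [CompactSpace T.V] :
    T.FinitelyManyEnds := by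
  refine Set.Finite.subset Set.finite_empty ?_
  rintro E ⟨x, -, hx, -⟩
  obtain ⟨C, hC⟩ := (isCompact_univ (X := T.V)).isBounded.subset_closedBall T.root
  obtain ⟨n, hn⟩ := (hx.eventually_gt_atTop C).exists
  have := hC (mem_univ (x n))
  rw [Metric.mem_closedBall, dist_comm] at this
  exact absurd hn (not_lt.2 this)

end MeasuredTree

/-! ### Closed subsets of the space of trees -/

namespace TreeSpace

/-- The classes of trees, with any number of ends, whose measure dominates the length measure. -/
def dominating : Set TreeSpace := mk '' {T | T.DominatesLength}

theorem mk_mem_dominating_iff {T : MeasuredTree} : mk T ∈ dominating ↔ T.DominatesLength :=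
  ⟨fun ⟨_, hT', h⟩ => (Quotient.exact h).dominatesLength hT', fun h => ⟨T, h, rfl⟩⟩

theorem isClosed_dominating : IsClosed dominating := by
  refine ⟨fun t ht => ?_⟩
  obtain ⟨T, rfl⟩ := Quotient.exists_rep t
  by_contra! hcon
  refine ht (mk_mem_dominating_iff.2 (T.dominatesLength_of_ghpDist_lt fun ε hε => ?_))
  obtain ⟨t', hlt, ht'⟩ := hcon ε hε
  obtain ⟨T', hT', rfl⟩ := not_not.1 ht'
  exact ⟨T', hT', hlt⟩

theorem finEnds_inter_dominating : finEnds ∩ dominating = finEndsLength := by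
  ext t
  constructor
  · rintro ⟨⟨T, hT, rfl⟩, h⟩
    exact ⟨T, ⟨hT, mk_mem_dominating_iff.1 h⟩, rfl⟩
  · rintro ⟨T, ⟨hT, h⟩, rfl⟩
    exact ⟨⟨T, hT, rfl⟩, mk_mem_dominating_iff.2 h⟩

theorem compactTrees_subset_finEnds : compactTrees ⊆ finEnds := by
  rintro _ ⟨T, hT, rfl⟩
  have : CompactSpace T.V := hT
  exact ⟨T, T.finitelyManyEnds_of_compactSpace, rfl⟩

theorem probTrees_subset_finEnds : probTrees ⊆ finEnds := by
  rintro _ ⟨T, ⟨hT, -⟩, rfl⟩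
  exact ⟨T, T.finitelyManyEnds_of_compactSpace, rfl⟩

theorem isClosed_preimage_finEndsLength {S : Set TreeSpace} (hS : S ⊆ finEnds) :
    IsClosed ((↑) ⁻¹' finEndsLength : Set S) := by
  have : ((↑) ⁻¹' finEndsLength : Set S) = (↑) ⁻¹' dominating := by
    ext t
    rw [mem_preimage, ← finEnds_inter_dominating]
    exact and_iff_right (hS t.2)
  rw [this]
  exact isClosed_dominating.preimage continuous_subtype_val

end TreeSpace

theorem proposition3p2 :
    -- `𝔗_e^ℓ`, `𝔗_f^ℓ`, `𝔗₁^ℓ` are closed in `𝔗_e`, `𝔗_f`, `𝔗₁`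
    IsClosed ((↑) ⁻¹' TreeSpace.finEndsLength : Set TreeSpace.finEnds) ∧
    IsClosed ((↑) ⁻¹' TreeSpace.compactTreesLength : Set TreeSpace.compactTrees) ∧
    IsClosed ((↑) ⁻¹' TreeSpace.probTreesLength : Set TreeSpace.probTrees) ∧
    -- the same inside the larger spaces where compactness is not required
    IsClosed ((↑) ⁻¹' TreeSpace.finEndsLength : Set TreeSpace.finEndsFiniteMeasure) ∧
    IsClosed ((↑) ⁻¹' TreeSpace.finEndsLength : Set TreeSpace.finEndsProbMeasure) := by
  refine ⟨TreeSpace.isClosed_preimage_finEndsLength Subset.rfl, ?_, ?_,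
    TreeSpace.isClosed_preimage_finEndsLength (image_mono fun _ h => h.1),
    TreeSpace.isClosed_preimage_finEndsLength (image_mono fun _ h => h.1)⟩
  · rw [TreeSpace.compactTreesLength, Subtype.preimage_coe_self_inter]
    exact TreeSpace.isClosed_preimage_finEndsLength TreeSpace.compactTrees_subset_finEnds
  · rw [TreeSpace.probTreesLength, Subtype.preimage_coe_self_inter]
    exact TreeSpace.isClosed_preimage_finEndsLength TreeSpace.probTrees_subset_finEnds
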